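/- Conventions. Let $X$ be a locally compact Hausdorff space. A measure on $X$ is a complex Radon measure: a linear functional $\mu$ on $C_c(X)$ such that for every compact $K\subseteq X$ there is a constant $C_K$ with $|\mu(\varphi)|\le C_K\|\varphi\|_\infty$ for all $\varphi\in C_c(X)$ supported in $K$. Its total variation $|\mu|$ is the positive regular Borel measure with $|\mu|(\varphi)=\sup\{|\mu(\psi)|:\psi\in C_c(X),\ |\psi|\le\varphi\}$ for $0\le\varphi\in C_c(X)$; for $g\in L^1(|\mu|)$, $\mu(g)$ denotes the value at $g$ of the continuous extension of $\mu$ to $L^1(|\mu|)$. For a locally compact abelian (Hausdorff) group $G$ and $t\in G$ let $(T^t\mu)(\varphi)=\mu(\varphi(\cdot+t))$. For a pre-compact set $A\subseteq G$ with non-empty interior let $\|\mu\|_A=\sup_{x\in G}|\mu|(x+A)$ (outer measure if $A$ is not measurable). The measure $\mu$ is norm almost periodic if $\|\mu\|_A<\infty$ and, for each $\varepsilon>0$, the set $P_\varepsilon^A(\mu)=\{t\in G:\|T^t\mu-\mu\|_A<\varepsilon\}$ is relatively dense, i.e. $P_\varepsilon^A(\mu)+K=G$ for some compact $K\subseteq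 G$. Let $d\ge 0$ be an integer, let $G$ be a $\sigma$-compact locally compact abelian group, $H_0$ a locally compact abelian group, and $H=\mathbb{R}^d\times H_0$. Let $(G,H,\mathcal{L})$ be a cut and project scheme, that is, $\mathcal{L}$ is a discrete cocompact subgroup of $G\times H$ whose projection to $H$ is dense and on which the projection to $G$ is one-to-one. Let $\rho$ be an $\mathcal{L}$-periodic measure on $G\times H$, that is, $T^\ell\rho=\rho$ for all $\ell\in\mathcal{L}$. Let $h:H\to\mathbb{C}$ be strongly admissible, that is, $h(x,y)=f(x)\varphi(y)$ for some bounded uniformly continuous $f:\mathbb{R}^d\to\mathbb{C}$ such that $(1+|x|^{2d})f(x)$ is bounded, and some $\varphi\in C_c(H_0)$. Then for each $\phi\in C_c(G)$ the function $(\phi\otimes h)(x,y)=\phi(x)h(y)$ is $|\rho|$-integrable, and $\rho_h(\phi):=\rho(\phi\otimes h)$ defines a measure $\rho_h$ on $G$. This measure $\rho_h$ is norm almost periodic, with respect to every pre-compact $A\subseteq G$ with non-empty interior. -/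

import Mathlib

open Set Filter Topology MeasureTheory
open scoped NNReal ENNReal CompactlySupported

namespace CutProject

/-! ### Complex Radon measures as functionals on `C_c(X, ℂ)` -/

section Radon

variable {X : Type*} [TopologicalSpace X]

/-- The space of (complex) Radon measures on `X`: linear functionals `μ` on `C_c(X, ℂ)` such that
for each compact `K` there is a constant `C` with `|μ(φ)| ≤ C ‖φ‖_∞` whenever `supp φ ⊆ K`. -/
noncomputable def radonSubmodule (X : Type*) [TopologicalSpace X] : Submodule ℂ (C_c(X, ℂ) →ₗ[ℂ] ℂ) where
  carrier := {μ | ∀ K : Set X, IsCompact K → ∃ C : ℝ, ∀ φ : C_c(X, ℂ),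
    tsupport φ ⊆ K → ‖μ φ‖ ≤ C * ⨆ x, ‖φ x‖}
  zero_mem' := fun _ _ => ⟨0, fun φ _ => by simp⟩
  add_mem' := by
    intro μ ν hμ hν K hK
    obtain ⟨C, hC⟩ := hμ K hK
    obtain ⟨D, hD⟩ := hν K hK
    refine ⟨C + D, fun φ hφ => ?_⟩
    rw [LinearMap.add_apply, add_mul]
    exact (norm_add_le _ _).trans (add_le_add (hC φ hφ) (hD φ hφ))
  smul_mem' := by
    intro c μ hμ K hK
    obtain ⟨C, hC⟩ := hμ K hK
    refine ⟨‖c‖ * C, fun φ hφ => ?_⟩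
    rw [LinearMap.smul_apply, norm_smul, mul_assoc]
    exact mul_le_mul_of_nonneg_left (hC φ hφ) (norm_nonneg c)

/-- Complex Radon measures on `X`. -/
noncomputable abbrev RadonMeasure (X : Type*) [TopologicalSpace X] : Type _ := radonSubmodule X

namespace RadonMeasure

noncomputable instance : CoeFun (RadonMeasure X) (fun _ => C_c(X, ℂ) → ℂ) := ⟨fun μ => μ.1⟩

/-- `|μ|(φ) = sup { |μ(ψ)| : ψ ∈ C_c(X), |ψ| ≤ φ }` for `0 ≤ φ ∈ C_c(X)`. -/
noncomputable def variationFun (μ : RadonMeasure X) (φ : C_c(X, ℝ≥0)) : ℝ≥0 :=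
  ⨆ ψ : {ψ : C_c(X, ℂ) // ∀ x, ‖ψ x‖₊ ≤ φ x}, ‖μ ψ.1‖₊

theorem bddAbove_variation (μ : RadonMeasure X) (φ : C_c(X, ℝ≥0)) :
    BddAbove (range fun ψ : {ψ : C_c(X, ℂ) // ∀ x, ‖ψ x‖₊ ≤ φ x} => ‖μ ψ.1‖₊) := by
  obtain ⟨C, hC⟩ := μ.2 (tsupport φ) φ.hasCompactSupport
  obtain ⟨B, hB⟩ := φ.continuous.bddAbove_range_of_hasCompactSupport φ.hasCompactSupport
  refine ⟨(max C 0 * B).toNNReal, ?_⟩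
  rintro _ ⟨⟨ψ, hψ⟩, rfl⟩
  have hsub : tsupport ψ ⊆ tsupport φ := by
    refine closure_mono fun x hx => ?_
    intro h0
    have h1 := hψ x
    rw [h0] at h1
    exact hx (by simpa using h1)
  have h2 : (⨆ x, ‖ψ x‖) ≤ B := by
    refine Real.iSup_le (fun x => ?_) B.2
    exact_mod_cast (hψ x).trans (hB ⟨x, rfl⟩)
  have h3 : (0 : ℝ) ≤ ⨆ x, ‖ψ x‖ := Real.iSup_nonneg fun x => norm_nonneg _
  rw [← NNReal.coe_le_coe, Real.coe_toNNReal _ (by positivity)]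
  calc ‖μ ψ‖ ≤ C * ⨆ x, ‖ψ x‖ := hC ψ hsub
    _ ≤ max C 0 * ⨆ x, ‖ψ x‖ := mul_le_mul_of_nonneg_right (le_max_left _ _) h3
    _ ≤ max C 0 * B := mul_le_mul_of_nonneg_left h2 (le_max_right _ _)

theorem nnnorm_le_variationFun (μ : RadonMeasure X) {φ : C_c(X, ℝ≥0)} {ψ : C_c(X, ℂ)}
    (h : ∀ x, ‖ψ x‖₊ ≤ φ x) : ‖μ ψ‖₊ ≤ μ.variationFun φ :=
  le_ciSup (μ.bddAbove_variation φ) ⟨ψ, h⟩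

theorem variationFun_le (μ : RadonMeasure X) {φ : C_c(X, ℝ≥0)} {c : ℝ≥0}
    (h : ∀ ψ : C_c(X, ℂ), (∀ x, ‖ψ x‖₊ ≤ φ x) → ‖μ ψ‖₊ ≤ c) : μ.variationFun φ ≤ c := by
  have : Nonempty {ψ : C_c(X, ℂ) // ∀ x, ‖ψ x‖₊ ≤ φ x} := ⟨⟨0, fun x => by simp⟩⟩
  exact ciSup_le fun ψ => h ψ.1 ψ.2

theorem exists_split (ψ : C_c(X, ℂ)) (φ₁ φ₂ : C_c(X, ℝ≥0)) (h : ∀ x, ‖ψ x‖₊ ≤ (φ₁ + φ₂) x) :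
    ∃ ψ₁ ψ₂ : C_c(X, ℂ), ψ₁ + ψ₂ = ψ ∧ (∀ x, ‖ψ₁ x‖₊ ≤ φ₁ x) ∧ (∀ x, ‖ψ₂ x‖₊ ≤ φ₂ x) := by
  have key : ∀ φ : C_c(X, ℝ≥0), φ ≤ φ₁ + φ₂ →
      ∃ ψ' : C_c(X, ℂ), ∀ x, ψ' x = ((φ x / (φ₁ + φ₂) x : ℝ≥0) : ℂ) * ψ x := by
    intro φ hφ
    have hle : ∀ x, ‖((φ x / (φ₁ + φ₂) x : ℝ≥0) : ℂ) * ψ x‖ ≤ ‖ψ x‖ := by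
      intro x
      rw [norm_mul]
      refine mul_le_of_le_one_left (norm_nonneg _) ?_
      have : ‖((φ x / (φ₁ + φ₂) x : ℝ≥0) : ℂ)‖ = ((φ x / (φ₁ + φ₂) x : ℝ≥0) : ℝ) :=
        Complex.norm_of_nonneg (NNReal.coe_nonneg _)
      rw [this]
      exact_mod_cast div_le_one_of_le₀ (hφ x) (zero_le)
    refine ⟨⟨⟨fun x => ((φ x / (φ₁ + φ₂) x : ℝ≥0) : ℂ) * ψ x, ?_⟩, ?_⟩, fun x => rfl⟩
    · rw [continuous_iff_continuousAt]
      intro x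
      by_cases hx : (φ₁ + φ₂) x = 0
      · have h0 : ψ x = 0 := by
          have := h x
          rw [hx] at this
          simpa using this
        have hlim : Tendsto (fun y => ‖ψ y‖) (𝓝 x) (𝓝 0) := by
          have := (ψ.continuous.norm).tendsto x
          simpa [h0] using this
        have := squeeze_zero_norm hle hlim
        simpa [ContinuousAt, h0] using this
      · have h1 : ContinuousAt (fun y => φ y / (φ₁ + φ₂) y) x :=
          φ.continuous.continuousAt.div₀ (φ₁ + φ₂).continuous.continuousAt hx
        have h2 : Continuous (fun r : ℝ≥0 => ((r : ℝ) : ℂ)) :=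
          Complex.continuous_ofReal.comp NNReal.continuous_coe
        exact (h2.continuousAt.comp h1).mul ψ.continuous.continuousAt
    · exact ψ.hasCompactSupport.mul_left
  obtain ⟨ψ₁, h₁⟩ := key φ₁ (fun x => by simp)
  obtain ⟨ψ₂, h₂⟩ := key φ₂ (fun x => by simp)
  have hb : ∀ (φ : C_c(X, ℝ≥0)) (ψ' : C_c(X, ℂ)), 
      (∀ x, ψ' x = ((φ x / (φ₁ + φ₂) x : ℝ≥0) : ℂ) * ψ x) → ∀ x, ‖ψ' x‖₊ ≤ φ x := by
    intro φ ψ' h' x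
    rw [h' x, nnnorm_mul]
    have : ‖((φ x / (φ₁ + φ₂) x : ℝ≥0) : ℂ)‖₊ = φ x / (φ₁ + φ₂) x := by
      ext
      exact Complex.norm_of_nonneg (NNReal.coe_nonneg _)
    rw [this]
    by_cases hx : (φ₁ + φ₂) x = 0
    · simp [hx]
    · calc φ x / (φ₁ + φ₂) x * ‖ψ x‖₊ ≤ φ x / (φ₁ + φ₂) x * (φ₁ + φ₂) x :=
            mul_le_mul_right (h x) _
        _ = φ x := div_mul_cancel₀ _ hx
  refine ⟨ψ₁, ψ₂, ?_, hb φ₁ ψ₁ h₁, hb φ₂ ψ₂ h₂⟩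
  ext x
  rw [CompactlySupportedContinuousMap.add_apply, h₁, h₂, ← add_mul]
  by_cases hx : (φ₁ + φ₂) x = 0
  · have h0 : ψ x = 0 := by
      have := h x
      rw [hx] at this
      simpa using this
    simp [h0]
  · have : φ₁ x / (φ₁ + φ₂) x + φ₂ x / (φ₁ + φ₂) x = 1 := by
      rw [← add_div]
      exact div_self hx
    have h3 : ((φ₁ x / (φ₁ + φ₂) x : ℝ≥0) : ℂ) + ((φ₂ x / (φ₁ + φ₂) x : ℝ≥0) : ℂ) = 1 := by
      exact_mod_cast congrArg (fun r : ℝ≥0 => ((r : ℝ) : ℂ)) this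
    rw [h3, one_mul]

theorem exists_phase (μ : RadonMeasure X) (ψ : C_c(X, ℂ)) :
    ∃ ψ' : C_c(X, ℂ), (∀ x, ‖ψ' x‖₊ ≤ ‖ψ x‖₊) ∧ μ ψ' = (‖μ ψ‖ : ℂ) := by
  by_cases h : μ ψ = 0
  · exact ⟨0, fun x => by simp, by simp [h]⟩
  · have hn : (‖μ ψ‖ : ℂ) ≠ 0 := by simpa using h
    refine ⟨((‖μ ψ‖ : ℂ) / μ ψ) • ψ, fun x => ?_, ?_⟩
    · rw [CompactlySupportedContinuousMap.smul_apply, smul_eq_mul, nnnorm_mul]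
      have : ‖(‖μ ψ‖ : ℂ) / μ ψ‖₊ = 1 := by
        rw [nnnorm_div]
        simp [h]
      rw [this, one_mul]
    · rw [map_smul, smul_eq_mul, div_mul_cancel₀ _ h]

theorem variationFun_add (μ : RadonMeasure X) (φ₁ φ₂ : C_c(X, ℝ≥0)) :
    μ.variationFun (φ₁ + φ₂) = μ.variationFun φ₁ + μ.variationFun φ₂ := by
  apply le_antisymm
  · refine μ.variationFun_le fun ψ hψ => ?_
    obtain ⟨ψ₁, ψ₂, rfl, h₁, h₂⟩ := exists_split ψ φ₁ φ₂ hψ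
    rw [map_add]
    exact (nnnorm_add_le _ _).trans
      (add_le_add (μ.nnnorm_le_variationFun h₁) (μ.nnnorm_le_variationFun h₂))
  · have hsum : ∀ ψ₁ ψ₂ : C_c(X, ℂ), (∀ x, ‖ψ₁ x‖₊ ≤ φ₁ x) → (∀ x, ‖ψ₂ x‖₊ ≤ φ₂ x) →
        ‖μ ψ₁‖₊ + ‖μ ψ₂‖₊ ≤ μ.variationFun (φ₁ + φ₂) := ?_
    · have h2 : μ.variationFun φ₂ ≤ μ.variationFun (φ₁ + φ₂) := μ.variationFun_le fun ψ₂ h₂ => by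
        simpa using hsum 0 ψ₂ (fun x => by simp) h₂
      refine add_le_of_le_tsub_right_of_le h2 (μ.variationFun_le fun ψ₁ h₁ => ?_)
      have h1 : ‖μ ψ₁‖₊ ≤ μ.variationFun (φ₁ + φ₂) := by
        simpa using hsum ψ₁ 0 h₁ (fun x => by simp)
      refine le_tsub_of_add_le_right (add_le_of_le_tsub_left_of_le h1 ?_)
      exact μ.variationFun_le fun ψ₂ h₂ => le_tsub_of_add_le_left (hsum ψ₁ ψ₂ h₁ h₂)
    intro ψ₁ ψ₂ hψ₁ hψ₂
    obtain ⟨θ₁, h₁, e₁⟩ := μ.exists_phase ψ₁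
    obtain ⟨θ₂, h₂, e₂⟩ := μ.exists_phase ψ₂
    have hθ : ∀ x, ‖(θ₁ + θ₂) x‖₊ ≤ (φ₁ + φ₂) x := fun x =>
      (nnnorm_add_le _ _).trans
        (add_le_add ((h₁ x).trans (hψ₁ x)) ((h₂ x).trans (hψ₂ x)))
    have := μ.nnnorm_le_variationFun hθ
    rw [map_add, e₁, e₂] at this
    convert this using 1
    ext
    rw [← Complex.ofReal_add]
    simp only [NNReal.coe_add, coe_nnnorm, Complex.norm_real, Real.norm_eq_abs]
    rw [abs_of_nonneg (by positivity)]

theorem variationFun_smul (μ : RadonMeasure X) (r : ℝ≥0) (φ : C_c(X, ℝ≥0)) :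
    μ.variationFun (r • φ) = r • μ.variationFun φ := by
  have main : ∀ (s : ℝ≥0) (θ : C_c(X, ℝ≥0)), s ≠ 0 →
      μ.variationFun (s • θ) ≤ s • μ.variationFun θ := by
    intro s θ hs
    refine μ.variationFun_le fun ψ hψ => ?_
    have hsc : (s : ℂ) ≠ 0 := by exact_mod_cast hs
    have hsn : ‖((s : ℝ) : ℂ)‖₊ = s := by ext; simp
    have h1 : ∀ x, ‖((((s : ℝ) : ℂ)⁻¹ • ψ : C_c(X, ℂ)) x)‖₊ ≤ θ x := by
      intro x
      rw [CompactlySupportedContinuousMap.smul_apply, smul_eq_mul, nnnorm_mul, nnnorm_inv, hsn]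
      calc s⁻¹ * ‖ψ x‖₊ ≤ s⁻¹ * (s * θ x) := mul_le_mul_right (hψ x) _
        _ = θ x := inv_mul_cancel_left₀ hs _
    have h2 := μ.nnnorm_le_variationFun h1
    rw [map_smul, smul_eq_mul, nnnorm_mul, nnnorm_inv, hsn] at h2
    calc ‖μ ψ‖₊ = s * (s⁻¹ * ‖μ ψ‖₊) := (mul_inv_cancel_left₀ hs _).symm
      _ ≤ s * μ.variationFun θ := mul_le_mul_right h2 _
  by_cases hr : r = 0
  · subst hr
    rw [zero_smul, zero_smul]
    refine le_antisymm (μ.variationFun_le fun ψ hψ => ?_) (zero_le)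
    have : ψ = 0 := by
      ext x
      simpa using hψ x
    simp [this]
  · apply le_antisymm (main r φ hr)
    have h := main r⁻¹ (r • φ) (inv_ne_zero hr)
    rw [smul_smul, inv_mul_cancel₀ hr, one_smul] at h
    calc r • μ.variationFun φ ≤ r • r⁻¹ • μ.variationFun (r • φ) := mul_le_mul_right h _
      _ = μ.variationFun (r • φ) := by rw [smul_smul, mul_inv_cancel₀ hr, one_smul]

/-- The total variation of `μ`, as a positive linear functional. -/
noncomputable def variation (μ : RadonMeasure X) : C_c(X, ℝ≥0) →ₗ[ℝ≥0] ℝ≥0 where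
  toFun := μ.variationFun
  map_add' := μ.variationFun_add
  map_smul' := μ.variationFun_smul

variable [T2Space X] [LocallyCompactSpace X]

/-- The total variation `|μ|` of `μ`, as the regular Borel measure that represents the positive
functional `φ ↦ |μ|(φ)`. It is a measure on the Borel σ-algebra of `X`, which is written out since
on a product space it may be larger than the product σ-algebra. -/
noncomputable def totalVariation (μ : RadonMeasure X) : @Measure X (borel X) :=
  letI : MeasurableSpace X := borel X
  have : BorelSpace X := ⟨rfl⟩
  NNRealRMK.rieszMeasure μ.variation

/-- `μ.HasIntegral g I`: the function `g` is `|μ|`-integrable and `∫ g dμ = I`. Here `∫ g dμ` is the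
value at `g` of the continuous extension of `μ : C_c(X, ℂ) → ℂ` to `L¹(|μ|)`, that is, the limit of
`μ(ψ)` as `ψ ∈ C_c(X, ℂ)` tends to `g` in `L¹(|μ|)`. -/
def HasIntegral (μ : RadonMeasure X) (g : X → ℂ) (I : ℂ) : Prop :=
  Integrable g μ.totalVariation ∧
    Tendsto (fun ψ : C_c(X, ℂ) => μ ψ)
      (comap (fun ψ : C_c(X, ℂ) => ∫⁻ x, ‖g x - ψ x‖ₑ ∂μ.totalVariation) (𝓝 0)) (𝓝 I)

end RadonMeasure

end Radon

/-! ### Translation, periodicity and norm almost periodicity -/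

section Group

variable {G : Type*} [AddCommGroup G] [TopologicalSpace G] [IsTopologicalAddGroup G]

/-- The translate `x ↦ φ (x - t)` of a function `φ ∈ C_c(G, ℂ)`. -/
noncomputable def translateFun (t : G) (φ : C_c(G, ℂ)) : C_c(G, ℂ) :=
  φ.comp (Homeomorph.subRight t).toCocompactMap

theorem translateFun_apply (t : G) (φ : C_c(G, ℂ)) (x : G) : translateFun t φ x = φ (x - t) := rfl

/-- `translateFun t` as a linear map. -/
noncomputable def translateLin (t : G) : C_c(G, ℂ) →ₗ[ℂ] C_c(G, ℂ) where
  toFun := translateFun t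
  map_add' := fun _ _ => by ext x; rfl
  map_smul' := fun _ _ => by ext x; rfl

/-- The translate `T^t μ` of a measure `μ`: `(T^t μ)(φ) = ∫ φ (x + t) dμ(x)`. -/
noncomputable def translate (t : G) (μ : RadonMeasure G) : RadonMeasure G :=
  ⟨μ.1.comp (translateLin (-t)), by
    intro K hK
    obtain ⟨C, hC⟩ := μ.2 ((fun x => x - t) '' K) (hK.image (continuous_id.sub continuous_const))
    refine ⟨C, fun φ hφ => ?_⟩
    have hsub : tsupport (translateFun (-t) φ) ⊆ (fun x => x - t) '' K := by
      intro x hx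
      have h1 : x + t ∈ tsupport φ := by
        have h2 : tsupport (φ ∘ Homeomorph.addRight t) = Homeomorph.addRight t ⁻¹' tsupport φ :=
          tsupport_comp_eq_preimage _ (Homeomorph.addRight t)
        have h3 : (translateFun (-t) φ : G → ℂ) = φ ∘ Homeomorph.addRight t := by
          funext y
          simp [translateFun_apply]
        rw [h3, h2] at hx
        exact hx
      exact ⟨x + t, hφ h1, add_sub_cancel_right x t⟩
    have hsup : (⨆ x, ‖translateFun (-t) φ x‖) = ⨆ x, ‖φ x‖ :=
      (Equiv.subRight (-t)).iSup_comp (g := fun x => ‖φ x‖)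
    have := hC (translateFun (-t) φ) hsub
    rw [hsup] at this
    exact this⟩

theorem translate_apply (t : G) (μ : RadonMeasure G) (φ : C_c(G, ℂ)) :
    translate t μ φ = μ (translateFun (-t) φ) := rfl

/-- `μ` is `L`-periodic if `T^t μ = μ` for all `t ∈ L`. -/
def IsPeriodic (L : AddSubgroup G) (μ : RadonMeasure G) : Prop :=
  ∀ t ∈ L, translate t μ = μ

/-- A subset `P` of `G` is relatively dense if `P + K = G` for some compact `K`. -/
def IsRelativelyDense (P : Set G) : Prop :=
  ∃ K : Set G, IsCompact K ∧ ∀ x : G, ∃ p ∈ P, ∃ k ∈ K, x = p + k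

variable [T2Space G] [LocallyCompactSpace G]

/-- The norm `‖μ‖_A = sup_{x ∈ G} |μ|(x + A)`, with values in `[0, ∞]`. -/
noncomputable def aNorm (A : Set G) (μ : RadonMeasure G) : ℝ≥0∞ :=
  ⨆ x : G, μ.totalVariation ((fun a => x + a) '' A)

/-- `μ` is translation bounded (with respect to the set `A`). -/
def IsTranslationBounded (A : Set G) (μ : RadonMeasure G) : Prop :=
  aNorm A μ < ∞

/-- The set `P_ε^A(μ)` of `ε`-norm almost periods of `μ`. -/
def normAlmostPeriods (A : Set G) (μ : RadonMeasure G) (ε : ℝ) : Set G :=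
  {t | aNorm A (translate t μ - μ) < ENNReal.ofReal ε}

/-- `μ` is norm almost periodic (with respect to the set `A`): it is translation bounded and, for
each `ε > 0`, its set of `ε`-norm almost periods is relatively dense. -/
def IsNormAlmostPeriodic (A : Set G) (μ : RadonMeasure G) : Prop :=
  IsTranslationBounded A μ ∧ ∀ ε : ℝ, 0 < ε → IsRelativelyDense (normAlmostPeriods A μ ε)

end Group

/-! ### Cut and project schemes and strongly admissible functions -/

section CPS

variable {G H : Type*} [AddCommGroup G] [TopologicalSpace G] [IsTopologicalAddGroup G]
  [AddCommGroup H] [TopologicalSpace H] [IsTopologicalAddGroup H]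

/-- `(G, H, L)` is a cut and project scheme, where `G`, `H` are locally compact abelian groups:
`G` is σ-compact, `L` is a lattice (a discrete cocompact subgroup) in `G × H` whose projection to
`H` is dense, and the projection to `G` is one-to-one on `L`. -/
structure IsCutAndProjectScheme (L : AddSubgroup (G × H)) : Prop where
  sigmaCompact : SigmaCompactSpace G
  discrete : DiscreteTopology L
  cocompact : CompactSpace ((G × H) ⧸ L)
  dense_snd : Dense (Prod.snd '' (L : Set (G × H)))
  injOn_fst : InjOn Prod.fst (L : Set (G × H))

/-- A function `h` on `ℝ^d × H₀` is strongly admissible if `h = f ⊗ φ` with `f` bounded and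
uniformly continuous on `ℝ^d`, `(1 + |x|^{2d}) f` bounded, and `φ ∈ C_c(H₀)`. -/
def IsStronglyAdmissible {d : ℕ} {H₀ : Type*} [TopologicalSpace H₀]
    (h : EuclideanSpace ℝ (Fin d) × H₀ → ℂ) : Prop :=
  ∃ (f : EuclideanSpace ℝ (Fin d) → ℂ) (φ : C_c(H₀, ℂ)),
    UniformContinuous f ∧ (∃ C : ℝ, ∀ x, ‖f x‖ ≤ C) ∧
    (∃ C : ℝ, ∀ x, ‖((1 + ‖x‖ ^ (2 * d) : ℝ) : ℂ) * f x‖ ≤ C) ∧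
    ∀ p, h p = f p.1 * φ p.2

variable [T2Space G] [LocallyCompactSpace G] [T2Space H] [LocallyCompactSpace H]

/-- `μ` is the projected measure `ρ_h`, i.e. `μ(φ) = ρ(φ ⊗ h)` for all `φ ∈ C_c(G)`, where
in particular `φ ⊗ h` is integrable with respect to `|ρ|`. -/
def IsProjectedMeasure (ρ : RadonMeasure (G × H)) (h : H → ℂ) (μ : RadonMeasure G) : Prop :=
  ∀ φ : C_c(G, ℂ), ρ.HasIntegral (fun p => φ p.1 * h p.2) (μ φ)

end CPS

end CutProject

/-! Periodicity under a cocompact group makes `|ρ|` translation bounded: `|ρ|(z + Q)` is bounded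
uniformly in `z` for every compact `Q`. Cover `ℝ^d` by balls of a fixed radius around the points of
a lattice. On the ball with index `i`, `‖h‖` is at most some `a i`, and `∑ a i < ∞`, because `(1 +
|x|^{2d})⁻¹` is summable over a lattice of rank `d < 2d` (for `d = 0` the lattice is finite). Hence
the integral of `|φ ⊗ h|` against `|ρ|` is at most a constant, depending on the support of `φ`,
times `‖φ‖_∞ ∑ a i`. This gives both integrability and the continuity of `ρ_h`; the same estimate
bounds `‖ρ_h‖_A`.

For `(s, w) ∈ L`, periodicity turns a translation in `G` into one in `H`: `T^s ρ_h - ρ_h = ρ_g` with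
`g = h(· - w) - h` (`IsProjectedMeasure.translate_sub`). If `w` is near `0`, then `‖g‖` is at most
`min δ (a i)` on the ball with index `i`, by uniform continuity and decay
(`IsStronglyAdmissible.exists_decay`). So `‖ρ_g‖_A ≤ C ∑ min δ (a i)` with `C` independent of `w`
(`IsPeriodic.exists_aNorm_le`), and the sum tends to `0` with `δ` by dominated convergence. The
almost periods thus contain a model set whose window is a neighbourhood of `0`, and such a set is
relatively dense (`IsCutAndProjectScheme.isRelativelyDense`). -/

namespace CutProject

namespace RadonMeasure

/-! ### Extension of a Radon measure to `L¹(|μ|)`. -/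

section Integral

variable {X : Type*} [TopologicalSpace X]

/-- The absolute value of a compactly supported continuous function. -/
noncomputable def absFun (ψ : C_c(X, ℂ)) : C_c(X, ℝ≥0) :=
  ⟨⟨fun x => ‖ψ x‖₊, ψ.continuous.nnnorm⟩, ψ.hasCompactSupport.comp_left nnnorm_zero⟩

variable [T2Space X] [LocallyCompactSpace X]

theorem regular_totalVariation (μ : RadonMeasure X) :
    letI : MeasurableSpace X := borel X
    μ.totalVariation.Regular := by
  let _ : MeasurableSpace X := borel X
  have : BorelSpace X := ⟨rfl⟩
  exact NNRealRMK.rieszMeasure_regular μ.variation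

theorem lintegral_totalVariation (μ : RadonMeasure X) (φ : C_c(X, ℝ≥0)) :
    ∫⁻ x, φ x ∂μ.totalVariation = μ.variationFun φ := by
  let _ : MeasurableSpace X := borel X
  have : BorelSpace X := ⟨rfl⟩
  exact NNRealRMK.lintegral_rieszMeasure μ.variation φ

/-- `ψ` is itself admissible in the supremum that defines `|μ|(|ψ|)`. -/
theorem enorm_apply_le (μ : RadonMeasure X) (ψ : C_c(X, ℂ)) :
    ‖μ ψ‖ₑ ≤ ∫⁻ x, ‖ψ x‖ₑ ∂μ.totalVariation := by
  have h := μ.lintegral_totalVariation (absFun ψ)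
  have h2 := μ.nnnorm_le_variationFun (φ := absFun ψ) (ψ := ψ) fun x => le_rfl
  calc ‖μ ψ‖ₑ = (‖μ ψ‖₊ : ℝ≥0∞) := rfl
    _ ≤ μ.variationFun (absFun ψ) := by exact_mod_cast h2
    _ = ∫⁻ x, ‖ψ x‖ₑ ∂μ.totalVariation := h.symm

theorem aestronglyMeasurable_of_continuous (μ : RadonMeasure X) {g : X → ℂ} (hg : Continuous g) :
    AEStronglyMeasurable[borel X] g μ.totalVariation := by
  let _ : MeasurableSpace X := borel X
  have : BorelSpace X := ⟨rfl⟩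
  exact hg.measurable.aestronglyMeasurable

/-- By regularity `t` is squeezed to a compact `s ⊆ t`, and `s` is enlarged to an open `u`, with
little loss of measure. A Urysohn function for `s ⊆ u`, times `c`, differs from the indicator only
on `(t \ s) ∪ (u \ s)`, and there by at most `‖c‖`. -/
theorem exists_eLpNorm_sub_indicator_le (μ : RadonMeasure X) (c : ℂ) {t : Set X}
    (ht : MeasurableSet[borel X] t) (htμ : μ.totalVariation t < ∞) {ε : ℝ≥0∞} (hε : ε ≠ 0) :
    ∃ ψ : C_c(X, ℂ), eLpNorm (⇑ψ - t.indicator fun _ => c) 1 μ.totalVariation ≤ ε := by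
  let _ : MeasurableSpace X := borel X
  have : BorelSpace X := ⟨rfl⟩
  have := μ.regular_totalVariation
  obtain ⟨η, hη0, hη⟩ := exists_eLpNorm_indicator_le (μ := μ.totalVariation) ENNReal.one_ne_top c hε
  have hη' : (η / 2 : ℝ≥0∞) ≠ 0 := (ENNReal.half_pos (by exact_mod_cast hη0.ne')).ne'
  obtain ⟨s, hst, hs, hsc, hμs⟩ := ht.exists_isCompact_isClosed_sdiff_lt htμ.ne hη'
  obtain ⟨u, hsu, hu, -, hμu⟩ := hsc.measurableSet.exists_isOpen_sdiff_lt
    ((measure_mono hst).trans_lt htμ).ne hη'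
  obtain ⟨χ, hχ1, hχ0, hχc, hχI⟩ := exists_continuous_one_zero_of_isCompact hs hu.isClosed_compl
    (disjoint_compl_right_iff_subset.2 hsu)
  let ψ : C_c(X, ℂ) := ⟨⟨fun x => (χ x : ℂ) * c, by fun_prop⟩,
    HasCompactSupport.mul_right (hχc.comp_left Complex.ofReal_zero)⟩
  refine ⟨ψ, le_trans (eLpNorm_mono fun x => ?_) (hη ((t \ s) ∪ (u \ s)) ?_)⟩
  · have hψ : ψ x = (χ x : ℂ) * c := rfl
    have hn : ‖((χ x : ℝ) : ℂ)‖ ≤ 1 := by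
      rw [Complex.norm_real, Real.norm_eq_abs, abs_of_nonneg (hχI x).1]
      exact (hχI x).2
    have hn' : ‖((χ x : ℝ) : ℂ) - 1‖ ≤ 1 := by
      rw [← Complex.ofReal_one, ← Complex.ofReal_sub, Complex.norm_real, Real.norm_eq_abs, abs_le]
      constructor <;> linarith [(hχI x).1, (hχI x).2]
    rw [Pi.sub_apply, hψ]
    by_cases hxs : x ∈ s
    · simp [hχ1 hxs, hxs, hst hxs]
    · by_cases hxt : x ∈ t
      · have hx : x ∈ (t \ s) ∪ (u \ s) := Or.inl ⟨hxt, hxs⟩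
        rw [indicator_of_mem hxt, indicator_of_mem hx, ← sub_one_mul, norm_mul]
        exact mul_le_of_le_one_left (norm_nonneg c) hn'
      · by_cases hxu : x ∈ u
        · have hx : x ∈ (t \ s) ∪ (u \ s) := Or.inr ⟨hxu, hxs⟩
          rw [indicator_of_notMem hxt, indicator_of_mem hx, sub_zero, norm_mul]
          exact mul_le_of_le_one_left (norm_nonneg c) hn
        · simp [hχ0 hxu, hxt, hxu]
  · calc _ ≤ _ := measure_union_le _ _
      _ ≤ (η / 2 : ℝ≥0∞) + η / 2 := add_le_add hμs.le hμu.le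
      _ = η := ENNReal.add_halves _

theorem exists_lintegral_sub_le (μ : RadonMeasure X) {g : X → ℂ}
    (hg : Integrable g μ.totalVariation) {ε : ℝ≥0∞} (hε : ε ≠ 0) :
    ∃ ψ : C_c(X, ℂ), ∫⁻ x, ‖g x - ψ x‖ₑ ∂μ.totalVariation ≤ ε := by
  let _ : MeasurableSpace X := borel X
  have : BorelSpace X := ⟨rfl⟩
  obtain ⟨k, hk, ψ, rfl⟩ := (memLp_one_iff_integrable.2 hg).induction_dense ENNReal.one_ne_top
    (fun k : X → ℂ => ∃ ψ : C_c(X, ℂ), ⇑ψ = k)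
    (fun c s hs hμs δ hδ => by
      obtain ⟨ψ, hψ⟩ := μ.exists_eLpNorm_sub_indicator_le c hs hμs hδ
      exact ⟨ψ, hψ, ψ, rfl⟩)
    (by rintro _ _ ⟨ψ, rfl⟩ ⟨θ, rfl⟩; exact ⟨ψ + θ, rfl⟩)
    (by rintro _ ⟨ψ, rfl⟩; exact μ.aestronglyMeasurable_of_continuous ψ.continuous) hε
  exact ⟨ψ, by simpa [eLpNorm_one_eq_lintegral_enorm] using hk⟩

/-- The filter along which elements of `C_c(X, ℂ)` approach `g` in `L¹(|μ|)`. -/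
noncomputable def approxFilter (μ : RadonMeasure X) (g : X → ℂ) : Filter C_c(X, ℂ) :=
  comap (fun ψ : C_c(X, ℂ) => ∫⁻ x, ‖g x - ψ x‖ₑ ∂μ.totalVariation) (𝓝 0)

theorem tendsto_approxFilter (μ : RadonMeasure X) (g : X → ℂ) :
    Tendsto (fun ψ : C_c(X, ℂ) => ∫⁻ x, ‖g x - ψ x‖ₑ ∂μ.totalVariation) (μ.approxFilter g)
      (𝓝 0) :=
  tendsto_comap

/-- Density of `C_c` in `L¹(|μ|)`. It makes the limit in `HasIntegral` non-vacuous, hence unique. -/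
theorem approxFilter_neBot (μ : RadonMeasure X) {g : X → ℂ}
    (hg : Integrable g μ.totalVariation) : (μ.approxFilter g).NeBot := by
  refine comap_neBot fun t ht => ?_
  obtain ⟨ε, hε, hε'⟩ := (ENNReal.nhds_zero_basis_Iic.mem_iff).1 ht
  obtain ⟨ψ, hψ⟩ := μ.exists_lintegral_sub_le hg hε.ne'
  exact ⟨ψ, hε' hψ⟩

theorem enorm_apply_sub_apply_le (μ : RadonMeasure X) {g : X → ℂ}
    (hg : AEStronglyMeasurable[borel X] g μ.totalVariation) (θ ψ : C_c(X, ℂ)) :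
    ‖μ θ - μ ψ‖ₑ ≤ ∫⁻ x, ‖g x - θ x‖ₑ ∂μ.totalVariation +
      ∫⁻ x, ‖g x - ψ x‖ₑ ∂μ.totalVariation := by
  let _ : MeasurableSpace X := borel X
  have : BorelSpace X := ⟨rfl⟩
  rw [← map_sub]
  refine (μ.enorm_apply_le (θ - ψ)).trans ?_
  rw [← lintegral_add_left']
  · refine lintegral_mono fun x => ?_
    have : (θ - ψ) x = (g x - ψ x) - (g x - θ x) := by
      rw [CompactlySupportedContinuousMap.sub_apply]; ring
    rw [this, add_comm]
    exact enorm_sub_le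
  · exact (hg.sub (μ.aestronglyMeasurable_of_continuous θ.continuous)).enorm

/-- Trades the limit for an inequality that is easy to transport. Forward: let `θ → g` in the bound
for `μ θ - μ ψ`. Backward: squeeze. -/
theorem hasIntegral_iff (μ : RadonMeasure X) (g : X → ℂ) (I : ℂ) :
    μ.HasIntegral g I ↔ Integrable g μ.totalVariation ∧
      ∀ ψ : C_c(X, ℂ), ‖I - μ ψ‖ₑ ≤ ∫⁻ x, ‖g x - ψ x‖ₑ ∂μ.totalVariation := by
  refine and_congr_right fun hg => ⟨fun h ψ => ?_, fun h => ?_⟩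
  · have := μ.approxFilter_neBot hg
    have h1 : Tendsto (fun θ : C_c(X, ℂ) => ‖μ θ - μ ψ‖ₑ) (μ.approxFilter g) (𝓝 ‖I - μ ψ‖ₑ) :=
      (continuous_enorm.tendsto _).comp (h.sub_const (μ ψ))
    have h2 := (μ.tendsto_approxFilter g).add_const (∫⁻ x, ‖g x - ψ x‖ₑ ∂μ.totalVariation)
    rw [zero_add] at h2
    exact le_of_tendsto_of_tendsto' h1 h2 fun θ => μ.enorm_apply_sub_apply_le hg.1 θ ψ
  · rw [tendsto_iff_edist_tendsto_0]
    refine tendsto_of_tendsto_of_tendsto_of_le_of_le tendsto_const_nhds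
      (μ.tendsto_approxFilter g) (fun _ => zero_le) fun ψ => ?_
    simp only
    rw [edist_comm, edist_eq_enorm_sub]
    exact h ψ

theorem HasIntegral.enorm_le {μ : RadonMeasure X} {g : X → ℂ} {I : ℂ} (h : μ.HasIntegral g I) :
    ‖I‖ₑ ≤ ∫⁻ x, ‖g x‖ₑ ∂μ.totalVariation := by
  simpa using ((μ.hasIntegral_iff g I).1 h).2 0

theorem HasIntegral.unique {μ : RadonMeasure X} {g : X → ℂ} {I J : ℂ} (hI : μ.HasIntegral g I)
    (hJ : μ.HasIntegral g J) : I = J := by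
  have := μ.approxFilter_neBot hI.1
  exact tendsto_nhds_unique (l := μ.approxFilter g) hI.2 hJ.2

theorem exists_hasIntegral (μ : RadonMeasure X) {g : X → ℂ}
    (hg : Integrable g μ.totalVariation) : ∃ I, μ.HasIntegral g I := by
  have := μ.approxFilter_neBot hg
  have hc : Cauchy (map (fun ψ : C_c(X, ℂ) => μ ψ) (μ.approxFilter g)) := by
    rw [EMetric.cauchy_iff]
    refine ⟨(this.map _).ne, fun ε hε => ?_⟩
    have h1 : ∀ᶠ ψ in μ.approxFilter g, ∫⁻ x, ‖g x - ψ x‖ₑ ∂μ.totalVariation < ε / 2 :=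
      (μ.tendsto_approxFilter g).eventually (gt_mem_nhds (ENNReal.half_pos hε.ne'))
    refine ⟨_, image_mem_map h1, ?_⟩
    rintro _ ⟨θ, hθ, rfl⟩ _ ⟨ψ, hψ, rfl⟩
    rw [edist_eq_enorm_sub]
    calc ‖μ θ - μ ψ‖ₑ ≤ _ := μ.enorm_apply_sub_apply_le hg.1 θ ψ
      _ < ε / 2 + ε / 2 := ENNReal.add_lt_add hθ hψ
      _ = ε := ENNReal.add_halves ε
  obtain ⟨I, hI⟩ := CompleteSpace.complete hc
  exact ⟨I, hg, hI⟩

theorem HasIntegral.add {μ : RadonMeasure X} {g k : X → ℂ} {I J : ℂ} (hI : μ.HasIntegral g I)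
    (hJ : μ.HasIntegral k J) : μ.HasIntegral (fun x => g x + k x) (I + J) := by
  let _ : MeasurableSpace X := borel X
  have : BorelSpace X := ⟨rfl⟩
  have hint : Integrable (fun x => g x + k x) μ.totalVariation := hI.1.add hJ.1
  obtain ⟨S, hS⟩ := μ.exists_hasIntegral hint
  suffices h : ‖S - (I + J)‖ₑ ≤ 0 by
    have : S = I + J := by simpa [sub_eq_zero] using h
    rwa [← this]
  -- Four errors of `ε / 4` each: two bound the distance from `S` to `μ (ψ + θ)`, and two those from
  -- `I` to `μ ψ` and from `J` to `μ θ`.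
  refine ENNReal.le_of_forall_pos_le_add fun ε hε _ => ?_
  have hε' : (ε : ℝ≥0∞) / 2 / 2 ≠ 0 :=
    (ENNReal.half_pos (ENNReal.half_pos (by exact_mod_cast hε.ne')).ne').ne'
  obtain ⟨ψ, hψ⟩ := μ.exists_lintegral_sub_le hI.1 hε'
  obtain ⟨θ, hθ⟩ := μ.exists_lintegral_sub_le hJ.1 hε'
  have h1 := (((μ.hasIntegral_iff _ _).1 hI).2 ψ).trans hψ
  have h2 := (((μ.hasIntegral_iff _ _).1 hJ).2 θ).trans hθ
  have h3 : ‖S - μ (ψ + θ)‖ₑ ≤ (ε : ℝ≥0∞) / 2 / 2 + (ε : ℝ≥0∞) / 2 / 2 := by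
    refine (((μ.hasIntegral_iff _ _).1 hS).2 (ψ + θ)).trans
      (le_trans ?_ (add_le_add hψ hθ))
    rw [← lintegral_add_left']
    · refine lintegral_mono fun x => ?_
      have : g x + k x - (ψ + θ) x = (g x - ψ x) + (k x - θ x) := by
        rw [CompactlySupportedContinuousMap.add_apply]; ring
      rw [this]
      exact enorm_add_le _ _
    · exact (hI.1.1.sub (μ.aestronglyMeasurable_of_continuous ψ.continuous)).enorm
  have : S - (I + J) = (S - μ (ψ + θ)) - ((I - μ ψ) + (J - μ θ)) := by
    rw [map_add]; ring
  rw [this, zero_add]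
  calc _ ≤ ‖S - μ (ψ + θ)‖ₑ + ‖(I - μ ψ) + (J - μ θ)‖ₑ := enorm_sub_le
    _ ≤ ((ε : ℝ≥0∞) / 2 / 2 + (ε : ℝ≥0∞) / 2 / 2) + ((ε : ℝ≥0∞) / 2 / 2 + (ε : ℝ≥0∞) / 2 / 2) :=
      add_le_add h3 ((enorm_add_le _ _).trans (add_le_add h1 h2))
    _ = ε := by rw [ENNReal.add_halves, ENNReal.add_halves]

theorem HasIntegral.const_mul {μ : RadonMeasure X} {g : X → ℂ} {I : ℂ} (hI : μ.HasIntegral g I)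
    (c : ℂ) : μ.HasIntegral (fun x => c * g x) (c * I) := by
  let _ : MeasurableSpace X := borel X
  have : BorelSpace X := ⟨rfl⟩
  have hint : Integrable (fun x => c * g x) μ.totalVariation := hI.1.const_mul c
  refine (μ.hasIntegral_iff _ _).2 ⟨hint, fun ψ => ?_⟩
  by_cases hc : c = 0
  · subst hc
    simpa using μ.enorm_apply_le ψ
  · have h := ((μ.hasIntegral_iff _ _).1 hI).2 (c⁻¹ • ψ)
    have e1 : c * I - μ ψ = c * (I - μ (c⁻¹ • ψ)) := by
      rw [map_smul, smul_eq_mul, mul_sub, mul_inv_cancel_left₀ hc]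
    have e2 : ∀ x, ‖c * g x - ψ x‖ₑ = ‖c‖ₑ * ‖g x - (c⁻¹ • ψ) x‖ₑ := fun x => by
      rw [← enorm_mul, CompactlySupportedContinuousMap.smul_apply, smul_eq_mul, mul_sub,
        mul_inv_cancel_left₀ hc]
    rw [e1, enorm_mul]
    simp_rw [e2]
    rw [lintegral_const_mul' _ _ enorm_ne_top]
    gcongr

theorem HasIntegral.sub {μ : RadonMeasure X} {g k : X → ℂ} {I J : ℂ} (hI : μ.HasIntegral g I)
    (hJ : μ.HasIntegral k J) : μ.HasIntegral (fun x => g x - k x) (I - J) := by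
  simpa [sub_eq_add_neg] using hI.add (hJ.const_mul (-1))

theorem totalVariation_le_variationFun (μ : RadonMeasure X) {B : Set X} {χ : C_c(X, ℝ≥0)}
    (h : ∀ x ∈ B, 1 ≤ χ x) : μ.totalVariation B ≤ μ.variationFun χ := by
  let _ : MeasurableSpace X := borel X
  have : BorelSpace X := ⟨rfl⟩
  rw [← μ.lintegral_totalVariation]
  have hm : MeasurableSet {x | 1 ≤ χ x} := measurableSet_le measurable_const χ.continuous.measurable
  calc μ.totalVariation B ≤ μ.totalVariation {x | 1 ≤ χ x} := measure_mono h
    _ = ∫⁻ x, {x | 1 ≤ χ x}.indicator 1 x ∂μ.totalVariation := (lintegral_indicator_one hm).symm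
    _ ≤ ∫⁻ x, χ x ∂μ.totalVariation := by
      refine lintegral_mono fun x => ?_
      by_cases hx : 1 ≤ χ x
      · simp [indicator, hx]
      · simp [indicator, hx]

theorem totalVariation_lt_top (μ : RadonMeasure X) {K : Set X} (hK : IsCompact K) :
    μ.totalVariation K < ∞ := by
  let _ : MeasurableSpace X := borel X
  have : BorelSpace X := ⟨rfl⟩
  have := μ.regular_totalVariation
  exact hK.measure_lt_top

end Integral

/-! ### Invariance of the variation and of the integral under periods. -/

section Translate

variable {X : Type*} [AddCommGroup X] [TopologicalSpace X] [IsTopologicalAddGroup X]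

theorem translate_eq_iff (t : X) (μ : RadonMeasure X) :
    translate t μ = μ ↔ ∀ φ, μ (translateFun (-t) φ) = μ φ :=
  ⟨fun h φ => by rw [← translate_apply, h], fun h => by
    apply Subtype.ext
    ext φ
    exact h φ⟩

/-- The translate `x ↦ φ (x + t)` of a nonnegative function. -/
noncomputable def translateNN (t : X) (φ : C_c(X, ℝ≥0)) : C_c(X, ℝ≥0) :=
  φ.comp (Homeomorph.addRight t).toCocompactMap

theorem translateNN_apply (t : X) (φ : C_c(X, ℝ≥0)) (x : X) : translateNN t φ x = φ (x + t) := rfl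

theorem variationFun_translateNN {t : X} {μ : RadonMeasure X} (ht : translate t μ = μ)
    (φ : C_c(X, ℝ≥0)) : μ.variationFun (translateNN t φ) = μ.variationFun φ := by
  rw [translate_eq_iff] at ht
  apply le_antisymm
  · refine μ.variationFun_le fun ψ hψ => ?_
    have h := ht (translateFun t ψ)
    have e : translateFun (-t) (translateFun t ψ) = ψ := by
      ext x; simp [translateFun_apply]
    rw [e] at h
    rw [h]
    refine μ.nnnorm_le_variationFun fun x => ?_
    have := hψ (x - t)
    simpa [translateFun_apply, translateNN_apply] using this
  · refine μ.variationFun_le fun ψ hψ => ?_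
    rw [← ht ψ]
    refine μ.nnnorm_le_variationFun fun x => ?_
    simpa [translateFun_apply, translateNN_apply] using hψ (x + t)

variable [T2Space X] [LocallyCompactSpace X]

/-- Both measures are regular, so it suffices to compare integrals of nonnegative functions in
`C_c`, where the variation is already invariant. -/
theorem map_totalVariation {t : X} {μ : RadonMeasure X} (ht : translate t μ = μ) :
    letI : MeasurableSpace X := borel X
    μ.totalVariation.map (Homeomorph.addRight t) = μ.totalVariation := by
  let _ : MeasurableSpace X := borel X
  have : BorelSpace X := ⟨rfl⟩
  have := μ.regular_totalVariation
  have : (μ.totalVariation.map (Homeomorph.addRight t)).Regular := Measure.Regular.map _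
  refine Measure.ext_of_integral_eq_on_compactlySupported_nnreal fun φ => ?_
  rw [integral_map (Homeomorph.addRight t).continuous.aemeasurable
    (by exact (NNReal.continuous_coe.comp φ.continuous).measurable.aestronglyMeasurable)]
  have h1 := NNRealRMK.integral_rieszMeasure μ.variation (translateNN t φ)
  have h2 := NNRealRMK.integral_rieszMeasure μ.variation φ
  have h3 := variationFun_translateNN ht φ
  exact h1.trans ((congrArg NNReal.toReal h3).trans h2.symm)

theorem measurePreserving_totalVariation {t : X} {μ : RadonMeasure X} (ht : translate t μ = μ) :
    letI : MeasurableSpace X := borel X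
    MeasurePreserving (Homeomorph.addRight t) μ.totalVariation μ.totalVariation := by
  let _ : MeasurableSpace X := borel X
  have : BorelSpace X := ⟨rfl⟩
  exact ⟨(Homeomorph.addRight t).continuous.measurable, map_totalVariation ht⟩

theorem lintegral_translate {t : X} {μ : RadonMeasure X} (ht : translate t μ = μ)
    (g : X → ℝ≥0∞) :
    ∫⁻ x, g (x + t) ∂μ.totalVariation = ∫⁻ x, g x ∂μ.totalVariation := by
  let _ : MeasurableSpace X := borel X
  have : BorelSpace X := ⟨rfl⟩
  exact (measurePreserving_totalVariation ht).lintegral_comp_emb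
    (Homeomorph.addRight t).measurableEmbedding g

theorem HasIntegral.translate {t : X} {μ : RadonMeasure X} (ht : translate t μ = μ) {g : X → ℂ}
    {I : ℂ} (h : μ.HasIntegral g I) : μ.HasIntegral (fun x => g (x + t)) I := by
  let _ : MeasurableSpace X := borel X
  have : BorelSpace X := ⟨rfl⟩
  rw [hasIntegral_iff] at h ⊢
  refine ⟨(measurePreserving_totalVariation ht).integrable_comp_of_integrable h.1, fun ψ => ?_⟩
  have h1 := h.2 (translateFun t ψ)
  have e : translateFun (-t) (translateFun t ψ) = ψ := by
    ext x; simp [translateFun_apply]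
  have h2 := (translate_eq_iff t μ).1 ht (translateFun t ψ)
  rw [e] at h2
  rw [← h2, ← lintegral_translate ht] at h1
  simpa [translateFun_apply] using h1

end Translate

end RadonMeasure

/-! ### Translation boundedness of periodic measures. -/

/-- A cocompact subgroup of a locally compact group has a compact set of representatives. -/
theorem exists_isCompact_add_mem {X : Type*} [AddCommGroup X] [TopologicalSpace X]
    [IsTopologicalAddGroup X] [LocallyCompactSpace X] (L : AddSubgroup X) [CompactSpace (X ⧸ L)] :
    ∃ K : Set X, IsCompact K ∧ ∀ x, ∃ l ∈ L, ∃ k ∈ K, x = l + k := by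
  choose C hC hCn using fun x : X => exists_compact_mem_nhds x
  obtain ⟨t, -, ht⟩ := (isCompact_univ (X := X ⧸ L)).elim_nhds_subcover
    (fun q => ((↑) : X → X ⧸ L) '' C q.out) fun q _ => by
      have h := (QuotientAddGroup.isOpenMap_coe (N := L)).image_mem_nhds (hCn q.out)
      rwa [QuotientAddGroup.out_eq'] at h
  refine ⟨⋃ q ∈ t, C q.out, t.isCompact_biUnion fun q _ => hC _, fun x => ?_⟩
  obtain ⟨q, hq, k, hk, hkx⟩ := mem_iUnion₂.1 (ht (mem_univ (x : X ⧸ L)))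
  exact ⟨-k + x, QuotientAddGroup.eq.1 hkx, k, mem_biUnion hq hk, by abel⟩

/-- A measure that is periodic with respect to a cocompact subgroup is translation bounded. -/
theorem IsPeriodic.exists_totalVariation_le {X : Type*} [AddCommGroup X] [TopologicalSpace X]
    [IsTopologicalAddGroup X] [T2Space X] [LocallyCompactSpace X] {L : AddSubgroup X}
    [CompactSpace (X ⧸ L)] {μ : RadonMeasure X} (hμ : IsPeriodic L μ) {Q : Set X}
    (hQ : IsCompact Q) :
    ∃ C < ∞, ∀ z, μ.totalVariation ((fun q => z + q) '' Q) ≤ C := by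
  let _ : MeasurableSpace X := borel X
  have : BorelSpace X := ⟨rfl⟩
  obtain ⟨K, hK, hKL⟩ := exists_isCompact_add_mem L
  -- For `z = l + k` the set `z + Q` lies in `l + (K + Q)`, and translation by `l` preserves `|μ|`;
  -- so `|μ|(K + Q)` is the uniform bound.
  have hKQ : IsCompact ((fun p : X × X => p.1 + p.2) '' K ×ˢ Q) := (hK.prod hQ).image continuous_add
  refine ⟨_, μ.totalVariation_lt_top hKQ, fun z => ?_⟩
  obtain ⟨l, hl, k, hk, rfl⟩ := hKL z
  have hp := RadonMeasure.measurePreserving_totalVariation (hμ l hl)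
  rw [← hp.measure_preimage_emb (Homeomorph.addRight l).measurableEmbedding]
  refine measure_mono ?_
  rintro y ⟨q, hq, hy⟩
  refine ⟨(k, q), ⟨hk, hq⟩, ?_⟩
  replace hy : l + k + q = y + l := hy
  rw [add_assoc, add_comm y] at hy
  exact add_left_cancel hy

/-- Bounding an integral by a sum over a cover by translates of a compact set. -/
theorem IsPeriodic.exists_lintegral_le_tsum {G E H₀ : Type*}
    [AddCommGroup G] [TopologicalSpace G] [IsTopologicalAddGroup G]
    [T2Space G] [LocallyCompactSpace G] [NormedAddCommGroup E] [ProperSpace E]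
    [AddCommGroup H₀] [TopologicalSpace H₀] [IsTopologicalAddGroup H₀]
    [T2Space H₀] [LocallyCompactSpace H₀] {L : AddSubgroup (G × (E × H₀))}
    [CompactSpace ((G × (E × H₀)) ⧸ L)] {ρ : RadonMeasure (G × (E × H₀))} (hρ : IsPeriodic L ρ)
    {ι : Type*} [Countable ι] (n : ι → E) {D : ℝ} (hn : ∀ u, ∃ i, ‖u - n i‖ ≤ D)
    {K : Set G} (hK : IsCompact K) {K' : Set H₀} (hK' : IsCompact K') :
    ∃ C < ∞, ∀ (x : G) (F : G × (E × H₀) → ℝ≥0∞) (S : ι → ℝ≥0∞),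
      (∀ p, F p ≠ 0 → p.1 - x ∈ K ∧ p.2.2 ∈ K') → (∀ i p, ‖p.2.1 - n i‖ ≤ D → F p ≤ S i) →
      ∫⁻ p, F p ∂ρ.totalVariation ≤ C * ∑' i, S i := by
  let _ : MeasurableSpace (G × (E × H₀)) := borel _
  have : BorelSpace (G × (E × H₀)) := ⟨rfl⟩
  have hQ : IsCompact (K ×ˢ (Metric.closedBall (0 : E) D ×ˢ K')) :=
    hK.prod ((isCompact_closedBall _ _).prod hK')
  obtain ⟨C, hC, hCz⟩ := hρ.exists_totalVariation_le hQ
  refine ⟨C, hC, fun x F S hF hS => ?_⟩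
  set B : ι → Set (G × (E × H₀)) := fun i =>
    (fun q => (x, n i, 0) + q) '' (K ×ˢ (Metric.closedBall (0 : E) D ×ˢ K'))
  have hB : ∀ i, MeasurableSet (B i) := fun i =>
    (hQ.image (continuous_const.add continuous_id)).measurableSet
  -- Each point where `F` is nonzero lies in some `B i` on which `F ≤ S i`. The sets may overlap,
  -- and `F` need not be measurable.
  calc ∫⁻ p, F p ∂ρ.totalVariation
      ≤ ∫⁻ p, ∑' i, (B i).indicator (fun _ => S i) p ∂ρ.totalVariation := by
        refine lintegral_mono fun p => ?_
        by_cases hp : F p = 0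
        · simp [hp]
        · obtain ⟨i, hi⟩ := hn p.2.1
          have hpB : p ∈ B i := ⟨p - (x, n i, 0),
            ⟨(hF p hp).1, by simpa using hi, by simpa using (hF p hp).2⟩, by simp⟩
          calc F p ≤ (B i).indicator (fun _ => S i) p := by
                rw [indicator_of_mem hpB]
                exact hS i p hi
            _ ≤ _ := ENNReal.le_tsum i
    _ = ∑' i, S i * ρ.totalVariation (B i) := by
        rw [lintegral_tsum fun i => (measurable_const.indicator (hB i)).aemeasurable]
        exact tsum_congr fun i => lintegral_indicator_const (hB i) _
    _ ≤ ∑' i, S i * C := ENNReal.tsum_le_tsum fun i => by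
        gcongr
        exact hCz _
    _ = C * ∑' i, S i := by rw [ENNReal.tsum_mul_right, mul_comm]

/-- Dominated convergence as `δ → 0⁺`, with `a` as the majorant. -/
theorem exists_pos_tsum_min_lt {ι : Type*} {a : ι → ℝ} (ha : Summable a) (ha0 : ∀ i, 0 ≤ a i)
    {ε : ℝ≥0∞} (hε : 0 < ε) : ∃ δ > 0, ∑' i, ENNReal.ofReal (min δ (a i)) < ε := by
  have h : Tendsto (fun δ : ℝ => ∑' i, min δ (a i)) (𝓝[>] 0) (𝓝 (∑' _ : ι, (0 : ℝ))) := by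
    refine tendsto_tsum_of_dominated_convergence ha (fun i => ?_) ?_
    · have h1 : Tendsto (fun δ : ℝ => min δ (a i)) (𝓝 0) (𝓝 (min 0 (a i))) :=
        (continuous_id.min continuous_const).tendsto 0
      rw [min_eq_left (ha0 i)] at h1
      exact h1.mono_left nhdsWithin_le_nhds
    · filter_upwards [self_mem_nhdsWithin] with δ hδ i
      rw [Real.norm_eq_abs, abs_of_nonneg (le_min (mem_Ioi.1 hδ).le (ha0 i))]
      exact min_le_right _ _
  rw [tsum_zero] at h
  have h2 := (ENNReal.tendsto_ofReal h).eventually (gt_mem_nhds (by simpa using hε))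
  obtain ⟨δ, hδ, hδ0⟩ := (h2.and self_mem_nhdsWithin).exists
  refine ⟨δ, hδ0, ?_⟩
  rwa [← ENNReal.ofReal_tsum_of_nonneg (fun i => le_min (mem_Ioi.1 hδ0).le (ha0 i))]
  exact ha.of_nonneg_of_le (fun i => le_min (mem_Ioi.1 hδ0).le (ha0 i)) fun i => min_le_right _ _

/-! ### Decay and uniform continuity of strongly admissible functions. -/

/-- The weight `(1 + |x|^{2d})⁻¹` is summable over the unit cubes of `ℝ^d`. -/
theorem exists_lattice_decay (d : ℕ) :
    ∃ (ι : Type) (_ : Countable ι) (n : ι → EuclideanSpace ℝ (Fin d)) (D : ℝ) (a : ι → ℝ),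
      (∀ u, ∃ i, ‖u - n i‖ ≤ D) ∧ Summable a ∧ (∀ i, 0 ≤ a i) ∧
      ∀ i u, ‖u - n i‖ ≤ D + 1 → 1 ≤ a i * (1 + ‖u‖ ^ (2 * d)) := by
  let b := (EuclideanSpace.basisFun (Fin d) ℝ).toBasis
  let L := Submodule.span ℤ (range b)
  set D : ℝ := ∑ i, ‖b i‖
  have hD : 0 ≤ D := Finset.sum_nonneg fun i _ => norm_nonneg _
  -- The factor `D + 2` comes from `1 + ‖l‖ ≤ (D + 2)(1 + ‖u‖)` for `‖u - l‖ ≤ D + 1`, the factor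
  -- `2` from `(1 + t)^(2d) ≤ 2^(2d) (1 + t^(2d))`. The slack `D + 1` later absorbs translations of
  -- norm less than `1`.
  set c : ℝ := ((D + 2) * 2) ^ (2 * d)
  refine ⟨L, inferInstance, fun l => l, D, fun l => c * ((1 + ‖l‖) ^ (2 * d))⁻¹, fun u => ?_,
    Summable.mul_left c ?_, fun l => by positivity, fun l u hu => ?_⟩
  · refine ⟨ZSpan.floor b u, ?_⟩
    rw [← ZSpan.fract_apply]
    exact ZSpan.norm_fract_le b u
  · rcases Nat.eq_zero_or_pos d with rfl | hd
    · have : Finite L := Subtype.finite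
      exact .of_finite
    · have hr : Module.finrank ℤ L < 2 * d := by
        rw [ZLattice.rank ℝ L, finrank_euclideanSpace_fin]
        omega
      refine Summable.of_norm_bounded_eventually (ZLattice.summable_norm_pow_inv L _ hr) ?_
      -- The comparison with `‖l‖⁻¹ ^ (2 * d)` fails at `l = 0`, where the inverse is `0` by
      -- convention.
      filter_upwards [(finite_singleton (0 : L)).compl_mem_cofinite] with l hl
      have hl0 : 0 < ‖l‖ := norm_pos_iff.2 hl
      rw [Real.norm_of_nonneg (by positivity), inv_pow]
      gcongr
      linarith
  · have h1 : 1 + ‖l‖ ≤ (D + 2) * (1 + ‖u‖) := by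
      have h2 : ‖(l : EuclideanSpace ℝ (Fin d))‖ ≤ ‖u‖ + ‖u - l‖ := by
        have := norm_sub_le u (u - l)
        rwa [sub_sub_cancel] at this
      have h3 : 0 ≤ (D + 1) * ‖u‖ := by positivity
      have h4 : ‖l‖ = ‖(l : EuclideanSpace ℝ (Fin d))‖ := rfl
      nlinarith
    have h5 : (1 + ‖u‖) ^ (2 * d) ≤ 2 ^ (2 * d) * (1 + ‖u‖ ^ (2 * d)) := by
      have h6 := add_pow_le zero_le_one (norm_nonneg u) (2 * d)
      rw [one_pow] at h6
      refine h6.trans ?_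
      gcongr
      · norm_num
      · omega
    have h7 : (1 + ‖l‖) ^ (2 * d) ≤ c * (1 + ‖u‖ ^ (2 * d)) := by
      calc (1 + ‖l‖) ^ (2 * d) ≤ ((D + 2) * (1 + ‖u‖)) ^ (2 * d) := by gcongr
        _ = (D + 2) ^ (2 * d) * (1 + ‖u‖) ^ (2 * d) := mul_pow _ _ _
        _ ≤ (D + 2) ^ (2 * d) * (2 ^ (2 * d) * (1 + ‖u‖ ^ (2 * d))) := by gcongr
        _ = c * (1 + ‖u‖ ^ (2 * d)) := by simp only [c, mul_pow]; ring
    rw [mul_right_comm, ← div_eq_mul_inv, one_le_div (by positivity)]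
    exact h7

theorem eventually_norm_sub_lt {X : Type*} [AddCommGroup X] [UniformSpace X] [IsUniformAddGroup X]
    {f : X → ℂ} (hf : UniformContinuous f) {δ : ℝ} (hδ : 0 < δ) :
    ∀ᶠ s in 𝓝 (0 : X), ∀ y, ‖f (y - s) - f y‖ < δ := by
  have h := hf (Metric.dist_mem_uniformity hδ)
  rw [mem_map, uniformity_eq_comap_nhds_zero X, mem_comap] at h
  obtain ⟨t, ht, hsub⟩ := h
  filter_upwards [ht] with s hs y
  have : (y - s, y) ∈ (fun p : X × X => p.2 - p.1) ⁻¹' t := by simpa using hs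
  rw [← dist_eq_norm]
  exact hsub this

theorem _root_.CompactlySupportedContinuousMap.eventually_norm_sub_lt {X : Type*} [AddCommGroup X]
    [TopologicalSpace X] [IsTopologicalAddGroup X] (φ : C_c(X, ℂ)) {δ : ℝ} (hδ : 0 < δ) :
    ∀ᶠ s in 𝓝 (0 : X), ∀ y, ‖φ (y - s) - φ y‖ < δ := by
  let _ := IsTopologicalAddGroup.rightUniformSpace X
  have : IsUniformAddGroup X := isUniformAddGroup_of_addCommGroup
  exact CutProject.eventually_norm_sub_lt
    (φ.hasCompactSupport.uniformContinuous_of_continuous φ.continuous) hδ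

theorem exists_norm_le {X : Type*} [TopologicalSpace X] (φ : C_c(X, ℂ)) :
    ∃ B, 0 ≤ B ∧ ∀ x, ‖φ x‖ ≤ B := by
  obtain ⟨B, hB⟩ := φ.hasCompactSupport.exists_bound_of_continuous φ.continuous
  exact ⟨max B 0, le_max_right _ _, fun x => (hB x).trans (le_max_left _ _)⟩

theorem norm_le_iSup {X : Type*} [TopologicalSpace X] (φ : C_c(X, ℂ)) (x : X) :
    ‖φ x‖ ≤ ⨆ y, ‖φ y‖ := by
  obtain ⟨B, -, hB⟩ := exists_norm_le φ
  exact le_ciSup (f := fun y => ‖φ y‖) ⟨B, by rintro _ ⟨y, rfl⟩; exact hB y⟩ x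

/-- The properties of a strongly admissible function that its projected measures depend on: it is
continuous with summable suprema over the members of a countable cover, and both these suprema and
the support are controlled uniformly for the differences with small translates. -/
theorem IsStronglyAdmissible.exists_decay {d : ℕ} {H₀ : Type*} [AddCommGroup H₀]
    [TopologicalSpace H₀] [IsTopologicalAddGroup H₀] [LocallyCompactSpace H₀]
    {h : EuclideanSpace ℝ (Fin d) × H₀ → ℂ} (hh : IsStronglyAdmissible h) :
    ∃ (ι : Type) (_ : Countable ι) (n : ι → EuclideanSpace ℝ (Fin d)) (D : ℝ) (a : ι → ℝ)
      (K' : Set H₀), (∀ u, ∃ i, ‖u - n i‖ ≤ D) ∧ Summable a ∧ (∀ i, 0 ≤ a i) ∧ IsCompact K' ∧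
      Continuous h ∧ (∀ p, h p ≠ 0 → p.2 ∈ K') ∧ (∀ i p, ‖p.1 - n i‖ ≤ D → ‖h p‖ ≤ a i) ∧
      (∀ᶠ s in 𝓝 0, (∀ p, h (p - s) - h p ≠ 0 → p.2 ∈ K') ∧
        ∀ i p, ‖p.1 - n i‖ ≤ D → ‖h (p - s) - h p‖ ≤ a i) ∧
      ∀ δ > 0, ∀ᶠ s in 𝓝 0, ∀ p, ‖h (p - s) - h p‖ ≤ δ := by
  obtain ⟨f, φ, hfu, ⟨B, hB⟩, ⟨C, hC⟩, hfφ⟩ := hh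
  obtain ⟨ι, hι, n, D, a, hcov, ha, ha0, had⟩ := exists_lattice_decay d
  obtain ⟨M, hM0, hM⟩ := exists_norm_le φ
  obtain ⟨V, hV, hV0⟩ := exists_compact_mem_nhds (0 : H₀)
  have hB0 : 0 ≤ B := (norm_nonneg _).trans (hB 0)
  have hC0 : 0 ≤ C := (norm_nonneg _).trans (hC 0)
  have hf : ∀ i u, ‖u - n i‖ ≤ D + 1 → ‖f u‖ ≤ C * a i := fun i u hu => by
    have h1 : (1 + ‖u‖ ^ (2 * d)) * ‖f u‖ ≤ C := by
      have := hC u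
      rwa [norm_mul, Complex.norm_of_nonneg (by positivity)] at this
    calc ‖f u‖ ≤ a i * (1 + ‖u‖ ^ (2 * d)) * ‖f u‖ :=
          le_mul_of_one_le_left (norm_nonneg _) (had i u hu)
      _ = a i * ((1 + ‖u‖ ^ (2 * d)) * ‖f u‖) := mul_assoc _ _ _
      _ ≤ a i * C := mul_le_mul_of_nonneg_left h1 (ha0 i)
      _ = C * a i := mul_comm _ _
  have hh1 : ∀ i p, ‖p.1 - n i‖ ≤ D + 1 → ‖h p‖ ≤ C * M * a i := fun i p hp => by
    rw [hfφ, norm_mul]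
    calc ‖f p.1‖ * ‖φ p.2‖ ≤ C * a i * M :=
          mul_le_mul (hf i _ hp) (hM _) (norm_nonneg _) (mul_nonneg hC0 (ha0 i))
      _ = C * M * a i := by ring
  have hsupp : ∀ p, h p ≠ 0 → p.2 ∈ tsupport φ := fun p hp =>
    subset_tsupport φ fun h0 => hp (by rw [hfφ, h0, mul_zero])
  have hCMa : ∀ i, 0 ≤ C * M * a i := fun i => mul_nonneg (mul_nonneg hC0 hM0) (ha0 i)
  -- The support is thickened by the compact neighbourhood `V` of `0`, so that it also contains the
  -- supports of small translates.
  have hK : ∀ y v, y - v ∈ tsupport φ → v ∈ V →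
      y ∈ (fun q : H₀ × H₀ => q.1 + q.2) '' tsupport φ ×ˢ V := fun y v hy hv =>
    ⟨(y - v, v), ⟨hy, hv⟩, sub_add_cancel y v⟩
  have hK0 : ∀ p, h p ≠ 0 → p.2 ∈ (fun q : H₀ × H₀ => q.1 + q.2) '' tsupport φ ×ˢ V :=
    fun p hp => hK _ 0 (by simpa using hsupp p hp) (mem_of_mem_nhds hV0)
  -- The factor `2` allows for differences: `h (p - s)` and `h p` each contribute at most `C * M * a
  -- i`.
  refine ⟨ι, hι, n, D, fun i => 2 * (C * M * a i), _, hcov, (ha.mul_left _).mul_left _,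
    fun i => by linarith [hCMa i], (φ.hasCompactSupport.isCompact.prod hV).image continuous_add,
    ?_, hK0, fun i p hp => ?_, ?_, fun δ hδ => ?_⟩
  · rw [show h = fun p => f p.1 * φ p.2 from funext hfφ]
    exact (hfu.continuous.comp continuous_fst).mul (φ.continuous.comp continuous_snd)
  · linarith [hh1 i p (by linarith), hCMa i]
  · have h1 : ∀ᶠ s : EuclideanSpace ℝ (Fin d) × H₀ in 𝓝 0, ‖s.1‖ < 1 :=
      (continuous_fst.norm.tendsto _).eventually (gt_mem_nhds (by simp))
    have h2 : ∀ᶠ s : EuclideanSpace ℝ (Fin d) × H₀ in 𝓝 0, s.2 ∈ V :=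
      (continuous_snd.tendsto _).eventually hV0
    filter_upwards [h1, h2] with s hs1 hs2
    refine ⟨fun p hp => ?_, fun i p hp => ?_⟩
    · by_cases h0 : h p = 0
      · rw [h0, sub_zero] at hp
        exact hK _ s.2 (hsupp _ hp) hs2
      · exact hK0 p h0
    · have h3 : ‖(p - s).1 - n i‖ ≤ D + 1 := by
        have : (p - s).1 - n i = (p.1 - n i) - s.1 := by rw [Prod.fst_sub]; abel
        rw [this]
        exact (norm_sub_le _ _).trans (add_le_add hp hs1.le)
      linarith [norm_sub_le (h (p - s)) (h p), hh1 i _ h3, hh1 i p (by linarith)]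
  · have hδ' : 0 < δ / (M + B + 1) := by positivity
    have h1 : ∀ᶠ s : EuclideanSpace ℝ (Fin d) × H₀ in 𝓝 0, ∀ y,
        ‖f (y - s.1) - f y‖ < δ / (M + B + 1) :=
      (continuous_fst.tendsto (0 : EuclideanSpace ℝ (Fin d) × H₀)).eventually
        (eventually_norm_sub_lt hfu hδ')
    have h2 : ∀ᶠ s : EuclideanSpace ℝ (Fin d) × H₀ in 𝓝 0, ∀ y,
        ‖φ (y - s.2) - φ y‖ < δ / (M + B + 1) :=
      (continuous_snd.tendsto (0 : EuclideanSpace ℝ (Fin d) × H₀)).eventually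
        (φ.eventually_norm_sub_lt hδ')
    filter_upwards [h1, h2] with s hs1 hs2 p
    have e : h (p - s) - h p =
        (f (p.1 - s.1) - f p.1) * φ (p.2 - s.2) + f p.1 * (φ (p.2 - s.2) - φ p.2) := by
      rw [hfφ, hfφ, Prod.fst_sub, Prod.snd_sub]; ring
    rw [e]
    calc _ ≤ ‖f (p.1 - s.1) - f p.1‖ * ‖φ (p.2 - s.2)‖ + ‖f p.1‖ * ‖φ (p.2 - s.2) - φ p.2‖ := by
          rw [← norm_mul, ← norm_mul]; exact norm_add_le _ _
      _ ≤ δ / (M + B + 1) * M + B * (δ / (M + B + 1)) := by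
          gcongr
          · exact (hs1 _).le
          · exact hM _
          · exact hB _
          · exact (hs2 _).le
      _ = δ * ((M + B) / (M + B + 1)) := by ring
      _ ≤ δ := mul_le_of_le_one_right hδ.le ((div_le_one (by positivity)).2 (by linarith))

/-! ### Relative density of model sets. -/

theorem IsRelativelyDense.mono {G : Type*} [AddCommGroup G] [TopologicalSpace G] {P P' : Set G}
    (hP : IsRelativelyDense P) (h : P ⊆ P') : IsRelativelyDense P' := by
  obtain ⟨K, hK, hKP⟩ := hP
  refine ⟨K, hK, fun x => ?_⟩
  obtain ⟨p, hp, hx⟩ := hKP x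
  exact ⟨p, h hp, hx⟩

/-- Model sets with a window that is a neighbourhood of `0` are relatively dense. -/
theorem IsCutAndProjectScheme.isRelativelyDense {G H : Type*} [AddCommGroup G] [TopologicalSpace G]
    [IsTopologicalAddGroup G] [AddCommGroup H] [TopologicalSpace H] [IsTopologicalAddGroup H]
    [LocallyCompactSpace G] [LocallyCompactSpace H] {L : AddSubgroup (G × H)}
    (hL : IsCutAndProjectScheme L) {U : Set H} (hU : U ∈ 𝓝 0) :
    IsRelativelyDense {s : G | ∃ w ∈ U, (s, w) ∈ L} := by
  have := hL.cocompact
  obtain ⟨K, hK, hKL⟩ := exists_isCompact_add_mem L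
  -- By density of the projection, each `k` is met by a lattice point up to an error in `U`.
  -- Openness and compactness then leave finitely many such points for all of the projection of `K`.
  have hl : ∀ k : H, ∃ l ∈ L, l.2 - k ∈ interior U := fun k => by
    obtain ⟨_, hw, l, hl, rfl⟩ := hL.dense_snd.inter_open_nonempty ((fun w => w - k) ⁻¹' interior U)
      (isOpen_interior.preimage (continuous_id.sub continuous_const))
      ⟨k, by simpa using mem_interior_iff_mem_nhds.2 hU⟩
    exact ⟨l, hl, hw⟩
  choose l hlL hlU using hl
  obtain ⟨t, -, ht⟩ := (hK.image continuous_snd).elim_nhds_subcover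
    (fun k => (fun w => (l k).2 - w) ⁻¹' interior U) fun k _ =>
      (isOpen_interior.preimage (continuous_const.sub continuous_id)).mem_nhds (hlU k)
  refine ⟨⋃ k ∈ t, (fun y : G × H => y.1 - (l k).1) '' K,
    t.isCompact_biUnion fun k _ => hK.image (continuous_fst.sub continuous_const), fun x => ?_⟩
  obtain ⟨m, hm, k, hk, hx⟩ := hKL (x, 0)
  obtain ⟨j, hj, hjk⟩ := mem_iUnion₂.1 (ht ⟨k, hk, rfl⟩)
  have h1 : x = m.1 + k.1 := congrArg Prod.fst hx
  have h2 : 0 = m.2 + k.2 := congrArg Prod.snd hx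
  -- Here `m.2 = -k.2`, so adding `l j` brings the internal coordinate to `(l j).2 - k.2 ∈ U`; the
  -- correction in `G` takes finitely many values and joins the compact part.
  refine ⟨m.1 + (l j).1, ⟨m.2 + (l j).2, ?_, add_mem hm (hlL j)⟩, k.1 - (l j).1,
    mem_biUnion hj ⟨k, hk, rfl⟩, by rw [h1]; abel⟩
  rw [eq_neg_of_add_eq_zero_left h2.symm, neg_add_eq_sub]
  exact interior_subset hjk

/-! ### The projected measure and its translates. -/

section Projection

variable {G H : Type*} [TopologicalSpace G] [TopologicalSpace H]
  [T2Space G] [LocallyCompactSpace G] [T2Space H] [LocallyCompactSpace H]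

/-- The bound `hb` yields integrability and then the Radon estimate; linearity follows from
uniqueness of the integral. -/
theorem exists_isProjectedMeasure (ρ : RadonMeasure (G × H)) {h : H → ℂ} (hc : Continuous h)
    (hb : ∀ K : Set G, IsCompact K → ∃ M < ∞, ∀ φ : C_c(G, ℂ), tsupport φ ⊆ K →
      ∫⁻ p, ‖φ p.1 * h p.2‖ₑ ∂ρ.totalVariation ≤ M * ENNReal.ofReal (⨆ x, ‖φ x‖)) :
    ∃ μ, IsProjectedMeasure ρ h μ := by
  have hint : ∀ φ : C_c(G, ℂ), Integrable (fun p : G × H => φ p.1 * h p.2) ρ.totalVariation := by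
    intro φ
    obtain ⟨M, hM, hφ⟩ := hb _ φ.hasCompactSupport
    exact ⟨ρ.aestronglyMeasurable_of_continuous
      ((φ.continuous.comp continuous_fst).mul (hc.comp continuous_snd)),
      (hφ φ subset_rfl).trans_lt (ENNReal.mul_lt_top hM ENNReal.ofReal_lt_top)⟩
  choose I hI using fun φ => ρ.exists_hasIntegral (hint φ)
  refine ⟨⟨{ toFun := I, map_add' := fun φ θ => ?_, map_smul' := fun c φ => ?_ },
    fun K hK => ?_⟩, hI⟩
  · refine (hI (φ + θ)).unique ?_
    simpa [add_mul] using (hI φ).add (hI θ)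
  · refine (hI (c • φ)).unique ?_
    simpa [mul_assoc] using (hI φ).const_mul c
  · obtain ⟨M, hM, hb⟩ := hb K hK
    refine ⟨M.toReal, fun φ hφ => ?_⟩
    have h1 := (hI φ).enorm_le.trans (hb φ hφ)
    have h2 := ENNReal.toReal_mono (ENNReal.mul_lt_top hM ENNReal.ofReal_lt_top).ne h1
    rwa [ENNReal.toReal_mul, ENNReal.toReal_ofReal (Real.iSup_nonneg fun x => norm_nonneg _),
      toReal_enorm] at h2

theorem IsProjectedMeasure.unique {ρ : RadonMeasure (G × H)} {h : H → ℂ} {μ ν : RadonMeasure G}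
    (hμ : IsProjectedMeasure ρ h μ) (hν : IsProjectedMeasure ρ h ν) : μ = ν := by
  apply Subtype.ext
  ext φ
  exact (hμ φ).unique (hν φ)

variable [AddCommGroup G] [IsTopologicalAddGroup G] [AddCommGroup H] [IsTopologicalAddGroup H]

/-- Translating a projected measure by `s` amounts to translating the function on the internal
space by `w`, for each `(s, w)` in the lattice. -/
theorem IsProjectedMeasure.translate_sub {L : AddSubgroup (G × H)} {ρ : RadonMeasure (G × H)}
    (hρ : IsPeriodic L ρ) {h : H → ℂ} {μ : RadonMeasure G} (hμ : IsProjectedMeasure ρ h μ) {s : G}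
    {w : H} (hs : (s, w) ∈ L) :
    IsProjectedMeasure ρ (fun y => h (y - w) - h y) (translate s μ - μ) := by
  intro φ
  have h1 := ((hμ (translateFun (-s) φ)).translate (hρ _ (neg_mem hs))).sub (hμ φ)
  have e : (fun p : G × H => φ p.1 * (h (p.2 - w) - h p.2)) = fun p =>
      translateFun (-s) φ (p + -(s, w)).1 * h (p + -(s, w)).2 - φ p.1 * h p.2 := by
    funext p
    simp [translateFun_apply, mul_add, sub_eq_add_neg]
  rw [e]
  exact h1

end Projection

theorem RadonMeasure.variationFun_le_of_enorm_le {X : Type*} [TopologicalSpace X]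
    (μ : RadonMeasure X) {φ : C_c(X, ℝ≥0)} {M : ℝ≥0∞}
    (h : ∀ ψ : C_c(X, ℂ), (∀ x, ‖ψ x‖₊ ≤ φ x) → ‖μ ψ‖ₑ ≤ M) : μ.variationFun φ ≤ M := by
  induction M with
  | top => exact le_top
  | coe c => exact ENNReal.coe_le_coe.2 (μ.variationFun_le fun ψ hψ => ENNReal.coe_le_coe.1 (h ψ hψ))

theorem exists_cutoff {X : Type*} [TopologicalSpace X] [T2Space X] [LocallyCompactSpace X]
    {K : Set X} (hK : IsCompact K) : ∃ χ : C_c(X, ℝ≥0), (∀ x ∈ K, χ x = 1) ∧ ∀ x, χ x ≤ 1 := by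
  obtain ⟨χ, hχ1, -, hχc, hχI⟩ := exists_continuous_one_zero_of_isCompact hK isClosed_empty
    (disjoint_empty K)
  refine ⟨⟨⟨fun x => (χ x).toNNReal, by fun_prop⟩, hχc.comp_left Real.toNNReal_zero⟩,
    fun x hx => ?_, fun x => ?_⟩
  · simpa using congrArg Real.toNNReal (hχ1 hx)
  · simpa using (hχI x).2

/-! ### Norm estimates for projected measures. -/

section Bound

variable {G E H₀ : Type*} [AddCommGroup G] [TopologicalSpace G] [IsTopologicalAddGroup G]
  [T2Space G] [LocallyCompactSpace G] [NormedAddCommGroup E] [ProperSpace E]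
  [AddCommGroup H₀] [TopologicalSpace H₀] [IsTopologicalAddGroup H₀]
  [T2Space H₀] [LocallyCompactSpace H₀] {L : AddSubgroup (G × (E × H₀))}
  [CompactSpace ((G × (E × H₀)) ⧸ L)] {ρ : RadonMeasure (G × (E × H₀))}
  {ι : Type*} [Countable ι] {n : ι → E} {D : ℝ} {K' : Set H₀}

theorem IsPeriodic.exists_lintegral_mul_le (hρ : IsPeriodic L ρ) (hn : ∀ u, ∃ i, ‖u - n i‖ ≤ D)
    (hK' : IsCompact K') {h : E × H₀ → ℂ} (hh : ∀ p, h p ≠ 0 → p.2 ∈ K') {a : ι → ℝ}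
    (ha : Summable a) (ha0 : ∀ i, 0 ≤ a i) (hha : ∀ i p, ‖p.1 - n i‖ ≤ D → ‖h p‖ ≤ a i)
    {K : Set G} (hK : IsCompact K) :
    ∃ M < ∞, ∀ φ : C_c(G, ℂ), tsupport φ ⊆ K →
      ∫⁻ p, ‖φ p.1 * h p.2‖ₑ ∂ρ.totalVariation ≤ M * ENNReal.ofReal (⨆ x, ‖φ x‖) := by
  obtain ⟨C, hC, hb⟩ := hρ.exists_lintegral_le_tsum n hn hK hK'
  refine ⟨C * ∑' i, ENNReal.ofReal (a i), ENNReal.mul_lt_top hC ?_, fun φ hφ => ?_⟩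
  · rw [← ENNReal.ofReal_tsum_of_nonneg ha0 ha]
    exact ENNReal.ofReal_lt_top
  · have := hb 0 (fun p => ‖φ p.1 * h p.2‖ₑ)
      (fun i => ENNReal.ofReal (a i) * ENNReal.ofReal (⨆ x, ‖φ x‖)) (fun p hp => ?_)
      fun i p hp => ?_
    · rwa [ENNReal.tsum_mul_right, ← mul_assoc] at this
    · have hp : φ p.1 ≠ 0 ∧ h p.2 ≠ 0 := by simpa using hp
      exact ⟨by simpa using hφ (subset_tsupport φ hp.1), hh _ hp.2⟩
    · rw [enorm_mul, mul_comm, ← ofReal_norm, ← ofReal_norm]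
      gcongr
      · exact hha i _ hp
      · exact norm_le_iSup φ _

/-- A translated cutoff dominates `x + A`; functions below it are at most `1` and supported in a
translate of one fixed compact set. `C` is chosen before `g`, so one constant serves `h` and all its
differences with small translates. -/
theorem IsPeriodic.exists_aNorm_le (hρ : IsPeriodic L ρ) (hn : ∀ u, ∃ i, ‖u - n i‖ ≤ D)
    (hK' : IsCompact K') {A : Set G} (hA : IsCompact (closure A)) :
    ∃ C < ∞, ∀ (g : E × H₀ → ℂ) (S : ι → ℝ) (μ : RadonMeasure G), (∀ p, g p ≠ 0 → p.2 ∈ K') →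
      (∀ i p, ‖p.1 - n i‖ ≤ D → ‖g p‖ ≤ S i) → IsProjectedMeasure ρ g μ →
      aNorm A μ ≤ C * ∑' i, ENNReal.ofReal (S i) := by
  obtain ⟨χ, hχ1, hχ⟩ := exists_cutoff hA
  obtain ⟨C, hC, hb⟩ := hρ.exists_lintegral_le_tsum n hn χ.hasCompactSupport.isCompact hK'
  refine ⟨C, hC, fun g S μ hg hS hμ => iSup_le fun x => ?_⟩
  refine (μ.totalVariation_le_variationFun (χ := RadonMeasure.translateNN (-x) χ) ?_).trans
    (μ.variationFun_le_of_enorm_le fun ψ hψ => (hμ ψ).enorm_le.trans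
      (hb x _ _ (fun p hp => ?_) fun i p hp => ?_))
  · rintro _ ⟨y, hy, rfl⟩
    simp [RadonMeasure.translateNN_apply, hχ1 y (subset_closure hy)]
  · have hp : ψ p.1 ≠ 0 ∧ g p.2 ≠ 0 := by simpa using hp
    refine ⟨subset_tsupport χ fun h0 => hp.1 ?_, hg _ hp.2⟩
    have := hψ p.1
    rw [RadonMeasure.translateNN_apply, ← sub_eq_add_neg, h0] at this
    simpa using this
  · have h1 : ‖ψ p.1‖ₑ ≤ 1 := by
      have : ‖ψ p.1‖₊ ≤ 1 := (hψ p.1).trans (hχ _)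
      exact ENNReal.coe_le_one_iff.2 this
    rw [enorm_mul, ← ofReal_norm (g p.2)]
    exact (mul_le_of_le_one_left zero_le h1).trans (ENNReal.ofReal_le_ofReal (hS i _ hp))

end Bound

end CutProject

theorem fact5p2 {d : ℕ} {G H₀ : Type*}
    [AddCommGroup G] [TopologicalSpace G] [IsTopologicalAddGroup G]
    [T2Space G] [LocallyCompactSpace G]
    [AddCommGroup H₀] [TopologicalSpace H₀] [IsTopologicalAddGroup H₀]
    [T2Space H₀] [LocallyCompactSpace H₀]
    (𝓛 : AddSubgroup (G × (EuclideanSpace ℝ (Fin d) × H₀)))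
    (h𝓛 : CutProject.IsCutAndProjectScheme 𝓛)
    (ρ : CutProject.RadonMeasure (G × (EuclideanSpace ℝ (Fin d) × H₀)))
    (hρ : CutProject.IsPeriodic 𝓛 ρ)
    (h : EuclideanSpace ℝ (Fin d) × H₀ → ℂ)
    (hh : CutProject.IsStronglyAdmissible h) :
    (∃! μ : CutProject.RadonMeasure G, CutProject.IsProjectedMeasure ρ h μ) ∧
    ∀ μ : CutProject.RadonMeasure G, CutProject.IsProjectedMeasure ρ h μ →
      ∀ A : Set G, IsCompact (closure A) → (interior A).Nonempty →
        CutProject.IsNormAlmostPeriodic A μ := by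
  have := h𝓛.cocompact
  obtain ⟨ι, _, n, D, a, K', hn, ha, ha0, hK', hc, hs, hha, hdiff, hδ⟩ := hh.exists_decay
  constructor
  · obtain ⟨μ, hμ⟩ := CutProject.exists_isProjectedMeasure ρ hc fun K hK =>
      hρ.exists_lintegral_mul_le hn hK' hs ha ha0 hha hK
    exact ⟨μ, hμ, fun ν hν => hν.unique hμ⟩
  · intro μ hμ A hA _
    obtain ⟨C, hC, hb⟩ := hρ.exists_aNorm_le hn hK' hA
    constructor
    · refine (hb h a μ hs hha hμ).trans_lt (ENNReal.mul_lt_top hC ?_)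
      rw [← ENNReal.ofReal_tsum_of_nonneg ha0 ha]
      exact ENNReal.ofReal_lt_top
    · intro ε hε
      have hε' : 0 < ENNReal.ofReal ε / (C + 1) :=
        ENNReal.div_pos (by simpa using hε) (by simpa using hC.ne)
      obtain ⟨δ, hδ0, hlt⟩ := CutProject.exists_pos_tsum_min_lt ha ha0 hε'
      refine (h𝓛.isRelativelyDense (hdiff.and (hδ δ hδ0))).mono ?_
      rintro s ⟨w, ⟨⟨hw1, hw2⟩, hw3⟩, hsw⟩
      -- For `w` in the window, `h(· - w) - h` is bounded both by `δ` everywhere and by `a i` on the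
      -- ball with index `i`.
      calc _ ≤ C * ∑' i, ENNReal.ofReal (min δ (a i)) :=
            hb _ _ _ hw1 (fun i p hp => le_min (hw3 p) (hw2 i p hp)) (hμ.translate_sub hρ hsw)
        _ ≤ (C + 1) * ∑' i, ENNReal.ofReal (min δ (a i)) := by gcongr; exact le_self_add
        _ < ENNReal.ofReal ε := ENNReal.mul_lt_of_lt_div' hlt
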